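/- Let $dg$ be the normalised Haar measure on $SU(2)$. For $\ell\in\frac12\mathbb{N}$ (with $0\in\mathbb N$) let $T_\ell$ be the irreducible representation of $SU(2)$ on homogeneous polynomials $F(x,y)$ of degree $2\ell$ with complex coefficients, $(T_\ell(g)F)(v)=F(vg)$ for row vectors $v=(x,y)$. For $m,n\in\{-\ell,-\ell+1,\dots,\ell\}$ let $t^\ell_{m,n}:SU(2)\to\mathbb{C}$ be its matrix elements in the standard basis $$\psi_n=\frac{x^{\ell-n}y^{\ell+n}}{\sqrt{(\ell-n)!\,(\ell+n)!}},\qquad T_\ell(g)\psi_n=\sum_{m=-\ell}^{\ell}t^\ell_{m,n}(g)\,\psi_m .$$ A function $h:SU(2)\to\mathbb{C}$ is called $SU(2)$-finite if it is continuous and its translates $g\mapsto h(gx)$, $x\in SU(2)$, span a finite-dimensional space. **Proposition.** The Mathieu Conjecture holds for $G=SU(2)$ and every sum of two matrix elements $$f=A_1t^{\ell_1}_{m_1,n_1}+A_2t^{\ell_2}_{m_2,n_2},$$ where $\ell_i\in\frac12\mathbb{N}$, $m_i,n_i\in\{-\ell_i,-\ell_i+1,\dots,\ell_i\}$, $A_1,A_2\in\mathbb{C}\setminus\{0\}$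 and $(\ell_1,m_1,n_1)\neq(\ell_2,m_2,n_2)$. That is, if $$\int_{SU(2)}f(g)^P\,dg=0\quad\text{for every integer }P>0,$$ then for every $SU(2)$-finite function $h:SU(2)\to\mathbb{C}$ there is $P_0\in\mathbb{N}$ such that $$\int_{SU(2)}f(g)^P\,h(g)\,dg=0\quad\text{for all integers }P\ge P_0 .$$ -/

import Mathlib

open MeasureTheory

/-- The group `SU(2)` of unitary complex `2 × 2` matrices of determinant one. -/
abbrev SU2 : Type := Matrix.specialUnitaryGroup (Fin 2) ℂ

namespace SU2

/-! ### `SU(2)` as a compact group, and its normalised Haar measure -/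

instance : IsTopologicalGroup SU2 where
  continuous_mul := by fun_prop
  continuous_inv := by
    refine Continuous.subtype_mk (f := fun A : SU2 => star (A : Matrix (Fin 2) (Fin 2) ℂ)) ?_ _
    exact continuous_star.comp continuous_subtype_val

instance : CompactSpace SU2 := by
  have hK : IsCompact {A : Matrix (Fin 2) (Fin 2) ℂ |
      ∀ i ∈ Set.univ, A i ∈ Set.univ.pi fun _ => Metric.closedBall (0 : ℂ) 1} :=
    isCompact_univ_pi fun _ => isCompact_univ_pi fun _ => isCompact_closedBall (0 : ℂ) 1
  have hS : IsClosed {A : Matrix (Fin 2) (Fin 2) ℂ | A * star A = 1 ∧ A.det = 1} :=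
    IsClosed.inter (isClosed_eq (continuous_id.mul continuous_star) continuous_const)
      (isClosed_eq continuous_id.matrix_det continuous_const)
  have h : ((Matrix.specialUnitaryGroup (Fin 2) ℂ : Submonoid _) :
      Set (Matrix (Fin 2) (Fin 2) ℂ)) = {A | A * star A = 1 ∧ A.det = 1} := by
    ext A
    simp [Matrix.mem_specialUnitaryGroup_iff, Matrix.mem_unitaryGroup_iff]
  have hc : IsCompact ((Matrix.specialUnitaryGroup (Fin 2) ℂ : Submonoid _) :
      Set (Matrix (Fin 2) (Fin 2) ℂ)) := by
    refine hK.of_isClosed_subset (h ▸ hS) fun A hA i _ j _ => ?_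
    rw [mem_closedBall_zero_iff]
    exact entry_norm_bound_of_unitary (Matrix.specialUnitaryGroup_le_unitaryGroup hA) i j
  exact isCompact_iff_compactSpace.mp hc

noncomputable instance : MeasurableSpace SU2 := borel SU2

instance : BorelSpace SU2 := ⟨rfl⟩

/-- The Haar measure of `SU(2)`, normalised to total mass one. -/
noncomputable def haar : Measure SU2 := Measure.haarMeasure ⊤

/-! ### The representations `T_ℓ` and their matrix elements -/

/-- For `g = !![α, β; γ, δ]`, the substitution `x ↦ α x + γ y`, `y ↦ β x + δ y` in polynomials in
two variables `x`, `y`: it sends `F` to `v ↦ F(v g)`, where `v = (x, y)` is a row vector. -/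
noncomputable def subst (g : SU2) : MvPolynomial (Fin 2) ℂ →ₐ[ℂ] MvPolynomial (Fin 2) ℂ :=
  MvPolynomial.aeval fun j : Fin 2 =>
    ∑ i : Fin 2, MvPolynomial.C ((g : Matrix (Fin 2) (Fin 2) ℂ) i j) * MvPolynomial.X i

theorem subst_X (g : SU2) (j : Fin 2) : subst g (MvPolynomial.X j) =
    ∑ i : Fin 2, MvPolynomial.C ((g : Matrix (Fin 2) (Fin 2) ℂ) i j) * MvPolynomial.X i := by
  rw [subst, MvPolynomial.aeval_X]

theorem subst_one : subst 1 = AlgHom.id ℂ _ := by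
  apply MvPolynomial.algHom_ext
  intro j
  rw [subst_X]
  fin_cases j <;> simp [Fin.sum_univ_two]

theorem subst_mul (g h : SU2) : subst (g * h) = (subst g).comp (subst h) := by
  apply MvPolynomial.algHom_ext
  intro j
  rw [AlgHom.comp_apply, subst_X, subst_X]
  simp only [Fin.sum_univ_two, map_add, map_mul, subst_X, MvPolynomial.algHom_C,
    MvPolynomial.algebraMap_eq, Submonoid.coe_mul, Matrix.mul_apply]
  ring

/-- The natural representation of `SU(2)` on polynomials in two variables, `(T(g) F)(v) = F(v g)`.
It preserves each space of homogeneous polynomials; its restriction to those of degree `2ℓ` is the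
irreducible representation `T_ℓ` of spin `ℓ`. -/
noncomputable def polyRep : Representation ℂ SU2 (MvPolynomial (Fin 2) ℂ) where
  toFun g := (subst g).toLinearMap
  map_one' := by rw [subst_one]; rfl
  map_mul' g h := by rw [subst_mul]; rfl

theorem isHomogeneous_polyRep (N : ℕ) (g : SU2) {F : MvPolynomial (Fin 2) ℂ}
    (hF : F.IsHomogeneous N) : (polyRep g F).IsHomogeneous N := by
  have h := hF.aeval (fun j : Fin 2 => ∑ i : Fin 2,
    MvPolynomial.C ((g : Matrix (Fin 2) (Fin 2) ℂ) i j) * MvPolynomial.X i) (n := 1) fun j =>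
      MvPolynomial.IsHomogeneous.sum _ _ _ fun i _ => MvPolynomial.isHomogeneous_C_mul_X _ i
  rw [one_mul] at h
  exact h

/-- `ℓ` is a spin, `ℓ ∈ ½ℕ`, and `m` is one of its weights, `m ∈ {-ℓ, -ℓ + 1, …, ℓ}`. -/
structure IsSpinWeight (ℓ m : ℚ) : Prop where
  spin : ∃ N : ℕ, 2 * ℓ = N
  weight : ∃ k : ℕ, (k : ℚ) ≤ 2 * ℓ ∧ m = -ℓ + k

/-- The normalising factor `√((ℓ - n)! (ℓ + n)!)`, where `ℓ - n` and `ℓ + n` are natural numbers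
when `n` is a weight of the spin `ℓ`. -/
noncomputable def basisNorm (ℓ n : ℚ) : ℝ :=
  √((Nat.factorial ⌊ℓ - n⌋₊ : ℝ) * (Nat.factorial ⌊ℓ + n⌋₊ : ℝ))

/-- The exponents of the monomial `x ^ (ℓ - n) * y ^ (ℓ + n)`. -/
noncomputable def basisExponent (ℓ n : ℚ) : Fin 2 →₀ ℕ :=
  Finsupp.single 0 ⌊ℓ - n⌋₊ + Finsupp.single 1 ⌊ℓ + n⌋₊

/-- The standard basis `ψ_n = x ^ (ℓ - n) * y ^ (ℓ + n) / √((ℓ - n)! (ℓ + n)!)`, for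
`n ∈ {-ℓ, …, ℓ}`, of the representation space of `T_ℓ`. It is orthonormal for an
`SU(2)`-invariant inner product, and `ψ_n` has weight `n` under the diagonal torus:
`T_ℓ(k(φ)) ψ_n = e ^ (-i n φ) ψ_n` for `k(φ) = diag(e ^ (i φ / 2), e ^ (-i φ / 2))`. -/
noncomputable def basisVec (ℓ n : ℚ) : MvPolynomial (Fin 2) ℂ :=
  MvPolynomial.monomial (basisExponent ℓ n) ((basisNorm ℓ n : ℂ)⁻¹)

/-- The matrix element `t^ℓ_{m,n}` of `T_ℓ` in the standard basis: the coefficient of `ψ_m` in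
`T_ℓ(g) ψ_n`, that is, `T_ℓ(g) ψ_n = ∑ m, t^ℓ_{m,n}(g) ψ_m`. -/
noncomputable def matrixElt (ℓ m n : ℚ) (g : SU2) : ℂ :=
  (basisNorm ℓ m : ℂ) * MvPolynomial.coeff (basisExponent ℓ m) (polyRep g (basisVec ℓ n))

end SU2

/-- A complex function on a topological group is `G`-finite if it is continuous and its translates
span a finite-dimensional space. (Right translates are used; for continuous, indeed for arbitrary,
functions this is equivalent to the condition on left translates, or on two-sided ones.) -/
def IsGFinite {G : Type*} [Group G] [TopologicalSpace G] (h : G → ℂ) : Prop :=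
  Continuous h ∧
    FiniteDimensional ℂ (Submodule.span ℂ (Set.range fun x : G => fun g : G => h (g * x)))

/-! Under left and right translation by the diagonal torus a matrix element has a weight in `ℤ × ℤ`,
and only functions of weight zero can have a nonzero integral. In the binomial expansion of `f ^ P`
the terms have weights `m • w₁ + n • w₂` with `m + n = P`, and everything depends on the nonnegative
relations between `w₁` and `w₂`.

If `m • w₁ + n • w₂ = 0` only for `m = n = 0`, each weight arises from finitely many pairs `(m, n)`.
A `G`-finite `h` pairs nontrivially with finitely many weights, so every term dies for large `P`
(`exists_forall_integral_eq_zero`).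

In the other cases some power of `f` has a nonzero integral, contrary to hypothesis. Given a
nontrivial relation with the weights not both zero, a single term of `f ^ (2 * (m + n))` has weight
zero. Up to a nonzero scalar it is the square of a real function that is not identically zero
(`exists_integral_pow_ne_zero`, `integral_sq_tau_mul_tau_ne_zero`).

If both weights vanish, `f` is a combination of two Legendre polynomials in `|α| ^ 2`, which is
uniformly distributed on `[0, 1]`. After scaling, the coefficients lie in `ℤ[z]`. If `P * N + 1 = p`
is prime, with `N` the larger degree, only the top term of the integral of the `P`-th power has
denominator `p`. Vanishing would then make `p` invertible in `ℤ[z]`, which is impossible for large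
`p`; Dirichlet's theorem supplies such primes. -/

namespace SU2

/-! ### Invariance of the Haar measure -/

instance : haar.IsHaarMeasure := by
  unfold haar
  infer_instance

instance : IsProbabilityMeasure haar :=
  ⟨by simpa [haar] using Measure.haarMeasure_self (G := SU2) (K₀ := ⊤)⟩

instance : haar.IsMulRightInvariant where
  map_mul_right_eq_self x := by
    have : (haar.map (· * x)).IsHaarMeasure := inferInstance
    have : IsProbabilityMeasure (haar.map (· * x)) :=
      Measure.isProbabilityMeasure_map (measurable_mul_const x).aemeasurable
    exact Measure.isHaarMeasure_eq_of_isProbabilityMeasure _ _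

theorem integrable_of_continuous {F : SU2 → ℂ} (hF : Continuous F) : Integrable F haar :=
  hF.integrable_of_hasCompactSupport (HasCompactSupport.of_compactSpace F)

theorem integral_mul_mul_eq_self (F : SU2 → ℂ) (k l : SU2) :
    ∫ g, F (k * g * l) ∂haar = ∫ g, F g ∂haar := by
  rw [integral_mul_left_eq_self (fun g => F (g * l)) k, integral_mul_right_eq_self]

/-! ### Weights under the diagonal torus -/

/-- The diagonal matrix `diag(u, u⁻¹)`. -/
noncomputable def torus (u : Circle) : SU2 :=
  ⟨!![(u : ℂ), 0; 0, (u : ℂ)⁻¹], by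
    rw [Matrix.mem_specialUnitaryGroup_iff, Matrix.mem_unitaryGroup_iff]
    constructor
    · ext i j
      fin_cases i <;> fin_cases j <;>
        simp [Matrix.mul_apply, Fin.sum_univ_two, Matrix.star_apply, ← Circle.coe_inv_eq_conj]
    · simp [Matrix.det_fin_two]⟩

/-- `F` transforms by the characters `u ^ p` and `v ^ q` under left and right translations by
the diagonal torus. -/
def HasWeight (F : SU2 → ℂ) (w : ℤ × ℤ) : Prop :=
  ∀ (u v : Circle) (g : SU2), F (torus u * g * torus v) = (u : ℂ) ^ w.1 * (v : ℂ) ^ w.2 * F g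

theorem torus_one : torus 1 = 1 := by
  ext i j
  fin_cases i <;> fin_cases j <;> simp [torus]

theorem HasWeight.mul {F G : SU2 → ℂ} {w z : ℤ × ℤ} (hF : HasWeight F w) (hG : HasWeight G z) :
    HasWeight (fun g => F g * G g) (w + z) := by
  intro u v g
  simp only [hF u v g, hG u v g, Prod.fst_add, Prod.snd_add,
    zpow_add₀ (Circle.coe_ne_zero u), zpow_add₀ (Circle.coe_ne_zero v)]
  ring

theorem HasWeight.pow {F : SU2 → ℂ} {w : ℤ × ℤ} (hF : HasWeight F w) (n : ℕ) :
    HasWeight (fun g => F g ^ n) (n • w) := by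
  intro u v g
  simp only [hF u v g, mul_pow, Prod.smul_fst, Prod.smul_snd]
  rw [nsmul_eq_mul, nsmul_eq_mul, mul_comm (n : ℤ), mul_comm (n : ℤ), zpow_mul, zpow_mul,
    zpow_natCast, zpow_natCast]

theorem HasWeight.const_mul {F : SU2 → ℂ} {w : ℤ × ℤ} (hF : HasWeight F w) (c : ℂ) :
    HasWeight (fun g => c * F g) w := by
  intro u v g
  simp only [hF u v g]
  ring

theorem exists_circle_zpow_ne_one {p : ℤ} (hp : p ≠ 0) : ∃ u : Circle, (u : ℂ) ^ p ≠ 1 := by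
  refine ⟨Circle.exp (Real.pi / p), ?_⟩
  have hp' : (p : ℂ) ≠ 0 := by exact_mod_cast hp
  have : ((Circle.exp (Real.pi / p) : Circle) : ℂ) ^ p = -1 := by
    rw [Circle.coe_exp, ← Complex.exp_int_mul, ← Complex.exp_pi_mul_I]
    congr 1
    push_cast
    field_simp
  rw [this]
  norm_num

/-- Translation by the torus preserves the integral but multiplies it by a character that is not
identically one. -/
theorem HasWeight.integral_eq_zero {F : SU2 → ℂ} {w : ℤ × ℤ} (hF : HasWeight F w) (hw : w ≠ 0) :
    ∫ g, F g ∂haar = 0 := by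
  have key (u v : Circle) :
      (u : ℂ) ^ w.1 * (v : ℂ) ^ w.2 * ∫ g, F g ∂haar = ∫ g, F g ∂haar := by
    conv_rhs => rw [← integral_mul_mul_eq_self F (torus u) (torus v)]
    simp only [hF u v, integral_const_mul]
  by_contra h
  by_cases h1 : w.1 = 0
  · have h2 : w.2 ≠ 0 := fun h2 => hw (Prod.ext h1 h2)
    obtain ⟨v, hv⟩ := exists_circle_zpow_ne_one h2
    have := key 1 v
    simp only [Circle.coe_one, one_zpow, one_mul] at this
    exact hv ((mul_eq_right₀ h).mp this)
  · obtain ⟨u, hu⟩ := exists_circle_zpow_ne_one h1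
    have := key u 1
    simp only [Circle.coe_one, one_zpow, mul_one] at this
    exact hu ((mul_eq_right₀ h).mp this)

/-! ### Finite functions meet only finitely many weights -/

/-- Distinct characters are linearly independent, so a finite-dimensional space contains only
finitely many. -/
theorem finite_zpow_mem (V : Submodule ℂ (Circle → ℂ)) [FiniteDimensional ℂ V] :
    {p : ℤ | (fun u : Circle => (u : ℂ) ^ p) ∈ V}.Finite := by
  let χ : ℤ → (Circle →* ℂ) := fun p =>
    { toFun := fun u => (u : ℂ) ^ p
      map_one' := by simp
      map_mul' := fun u v => by simp [mul_zpow] }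
  have hinj : Function.Injective χ := by
    intro p q hpq
    by_contra hne
    obtain ⟨u, hu⟩ := exists_circle_zpow_ne_one (sub_ne_zero.mpr hne)
    apply hu
    have h : (u : ℂ) ^ p = (u : ℂ) ^ q := DFunLike.congr_fun hpq u
    rw [zpow_sub₀ (Circle.coe_ne_zero u), h, div_self (zpow_ne_zero _ (Circle.coe_ne_zero u))]
  have hli : LinearIndependent ℂ fun p : ℤ => (χ p : Circle → ℂ) :=
    (linearIndependent_monoidHom Circle ℂ).comp χ hinj
  let s := {p : ℤ | (fun u : Circle => (u : ℂ) ^ p) ∈ V}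
  have hmem (p : s) : (χ p : Circle → ℂ) ∈ V := p.2
  have hli' : LinearIndependent ℂ fun p : s => (⟨χ p, hmem p⟩ : V) := by
    apply LinearIndependent.of_comp V.subtype
    exact hli.comp _ Subtype.val_injective
  have := hli'.finite
  exact Set.toFinite s

end SU2

/-! ### Separation of variables for translates of `G`-finite functions -/

section Finite

/-- Linear functionals on a finite-dimensional Hausdorff space are continuous, hence so are
coordinates along a continuous map. -/
theorem exists_continuous_coord {E X : Type*} [AddCommGroup E] [Module ℂ E] [TopologicalSpace E]
    [T2Space E] [IsTopologicalAddGroup E] [ContinuousSMul ℂ E] [TopologicalSpace X] {Φ : X → E}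
    (hΦ : Continuous Φ) [FiniteDimensional ℂ (Submodule.span ℂ (Set.range Φ))] :
    ∃ (n : ℕ) (v : Fin n → E) (c : Fin n → X → ℂ), (∀ i, Continuous (c i)) ∧
      ∀ x, Φ x = ∑ i, c i x • v i := by
  let b := Module.finBasis ℂ (Submodule.span ℂ (Set.range Φ))
  have hmem (x : X) : Φ x ∈ Submodule.span ℂ (Set.range Φ) := Submodule.subset_span ⟨x, rfl⟩
  refine ⟨_, fun i => b i, fun i x => b.coord i ⟨Φ x, hmem x⟩, fun i => ?_, fun x => ?_⟩
  · exact (LinearMap.continuous_of_finiteDimensional (b.coord i)).comp (hΦ.subtype_mk hmem)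
  · have := congrArg Subtype.val (b.sum_repr ⟨Φ x, hmem x⟩)
    rw [AddSubmonoidClass.coe_finsetSum] at this
    exact this.symm

variable {G : Type*} [Group G] [TopologicalSpace G] [IsTopologicalGroup G]

/-- Translates of a `G`-finite function separate variables, with continuous factors. -/
theorem IsGFinite.exists_eq_sum {h : G → ℂ} (hh : IsGFinite h) :
    ∃ (n : ℕ) (v c : Fin n → G → ℂ), (∀ i, Continuous (v i)) ∧ (∀ i, Continuous (c i)) ∧
      ∀ g x, h (g * x) = ∑ i, v i g * c i x := by
  obtain ⟨hc, hfin⟩ := hh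
  -- Currying makes `x ↦ h (· * x)` continuous for the compact-open topology, which gives continuity
  -- of the coefficients `c i`.
  let Φ : C(G, C(G, ℂ)) := ContinuousMap.curry ⟨fun p : G × G => h (p.2 * p.1), by fun_prop⟩
  let V : Submodule ℂ C(G, ℂ) := Submodule.span ℂ (Set.range Φ)
  let E : C(G, ℂ) →ₗ[ℂ] (G → ℂ) := ContinuousMap.coeFnLinearMap ℂ
  have hV : FiniteDimensional ℂ V := by
    have himg : V.map E =
        Submodule.span ℂ (Set.range fun x : G => fun g : G => h (g * x)) := by
      rw [Submodule.map_span, ← Set.range_comp]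
      rfl
    have hE : Function.Injective E := DFunLike.coe_injective
    have : FiniteDimensional ℂ (V.map E) := himg ▸ hfin
    exact (Submodule.equivMapOfInjective E hE V).symm.finiteDimensional
  obtain ⟨n, v, c, hcc, hsum⟩ := exists_continuous_coord Φ.continuous
  refine ⟨n, fun i => v i, c, fun i => (v i).continuous, hcc, fun g x => ?_⟩
  have h1 : h (g * x) = Φ x g := rfl
  rw [h1, hsum, ContinuousMap.sum_apply]
  exact Finset.sum_congr rfl fun i _ => by simp [mul_comm]

end Finite

namespace SU2

/-- Moving a torus element from `F` to `h` shows that `u ^ w.1` times the integral is a combination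
of the functions `v i (torus u⁻¹)`; likewise `w.2` with the `c i`. If the integral is nonzero, both
characters lie in fixed finite-dimensional spaces. -/
theorem exists_finite_weights {h : SU2 → ℂ} (hh : IsGFinite h) :
    ∃ S : Set (ℤ × ℤ), S.Finite ∧ ∀ (F : SU2 → ℂ) (w : ℤ × ℤ), Continuous F → HasWeight F w →
      w ∉ S → ∫ g, F g * h g ∂haar = 0 := by
  obtain ⟨n, v, c, hv, hc, hsum⟩ := hh.exists_eq_sum
  let V : (Fin n → SU2 → ℂ) → Submodule ℂ (Circle → ℂ) := fun f =>
    Submodule.span ℂ (Set.range fun i => fun u : Circle => f i (torus u⁻¹))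
  have hfin (f) : FiniteDimensional ℂ (V f) := FiniteDimensional.span_of_finite ℂ (Set.finite_range _)
  have hinv (u : Circle) : torus u⁻¹ * torus u = 1 := by
    ext i j
    fin_cases i <;> fin_cases j <;> simp [torus]
  refine ⟨_, (finite_zpow_mem (V v)).prod (finite_zpow_mem (V c)), fun F w hF hw hwS => ?_⟩
  by_contra hne
  have hcomb (f : Fin n → SU2 → ℂ) (k : Fin n → ℂ) (p : ℤ)
      (H : ∀ u : Circle, (u : ℂ) ^ p * ∫ g, F g * h g ∂haar = ∑ i, f i (torus u⁻¹) * k i) :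
      (fun u : Circle => (u : ℂ) ^ p) ∈ V f := by
    have : (fun u : Circle => (u : ℂ) ^ p) =
        ∑ i, (k i / ∫ g, F g * h g ∂haar) • fun u : Circle => f i (torus u⁻¹) := by
      ext u
      rw [Finset.sum_apply]
      simp only [Pi.smul_apply, smul_eq_mul]
      rw [eq_div_of_mul_eq hne (H u), Finset.sum_div]
      exact Finset.sum_congr rfl fun i _ => by ring
    rw [this]
    exact Submodule.sum_mem _ fun i _ => Submodule.smul_mem _ _ (Submodule.subset_span ⟨i, rfl⟩)
  apply hwS
  constructor
  · refine hcomb v (fun i => ∫ g, F g * c i g ∂haar) w.1 fun u => ?_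
    have h1 : (u : ℂ) ^ w.1 * ∫ g, F g * h g ∂haar = ∫ g, F g * h (torus u⁻¹ * g) ∂haar := by
      rw [← integral_mul_left_eq_self (fun g => F g * h (torus u⁻¹ * g)) (torus u),
        ← integral_const_mul]
      refine integral_congr_ae (.of_forall fun g => ?_)
      have := hw u 1 g
      simp only [torus_one, mul_one, Circle.coe_one, one_zpow] at this
      simp only [← mul_assoc, hinv, one_mul, this]
    rw [h1]
    simp only [hsum, Finset.mul_sum]
    rw [integral_finsetSum]
    swap
    · exact fun i _ => integrable_of_continuous (hF.mul (continuous_const.mul (hc i)))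
    refine Finset.sum_congr rfl fun i _ => ?_
    rw [← integral_const_mul]
    exact integral_congr_ae (.of_forall fun g => by ring)
  · refine hcomb c (fun i => ∫ g, F g * v i g ∂haar) w.2 fun u => ?_
    have h1 : (u : ℂ) ^ w.2 * ∫ g, F g * h g ∂haar = ∫ g, F g * h (g * torus u⁻¹) ∂haar := by
      rw [← integral_mul_right_eq_self (fun g => F g * h (g * torus u⁻¹)) (torus u),
        ← integral_const_mul]
      refine integral_congr_ae (.of_forall fun g => ?_)
      have := hw 1 u g
      simp only [torus_one, one_mul, Circle.coe_one, one_zpow] at this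
      have h2 : torus u * torus u⁻¹ = 1 := by simpa using hinv u⁻¹
      simp only [mul_assoc, h2, mul_one, this]
    rw [h1]
    simp only [hsum, Finset.mul_sum]
    rw [integral_finsetSum]
    swap
    · exact fun i _ => integrable_of_continuous (hF.mul ((hv i).mul continuous_const))
    refine Finset.sum_congr rfl fun i _ => ?_
    rw [← integral_const_mul]
    exact integral_congr_ae (.of_forall fun g => by ring)

end SU2

namespace SU2

/-! ### Matrix elements as explicit polynomials in the entries -/

/-- The coefficient of `x ^ c` in `(α x + γ y) ^ a * (β x + δ y) ^ b`, where `α, β, γ, δ` are the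
entries of `g`. -/
noncomputable def tau (a b c : ℕ) (g : SU2) : ℂ :=
  ∑ x ∈ Finset.HasAntidiagonal.antidiagonal c, (a.choose x.1 * b.choose x.2 : ℂ) *
    (g.1 0 0 ^ x.1 * g.1 1 0 ^ (a - x.1) * (g.1 0 1 ^ x.2 * g.1 1 1 ^ (b - x.2)))

theorem continuous_entry (i j : Fin 2) : Continuous fun g : SU2 => g.1 i j :=
  (continuous_apply_apply i j).comp continuous_subtype_val

theorem continuous_tau (a b c : ℕ) : Continuous (tau a b c) := by
  unfold tau
  have h00 := continuous_entry 0 0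
  have h01 := continuous_entry 0 1
  have h10 := continuous_entry 1 0
  have h11 := continuous_entry 1 1
  exact continuous_finsetSum _ fun x _ => continuous_const.mul
    (((h00.pow _).mul (h10.pow _)).mul ((h01.pow _).mul (h11.pow _)))

theorem coeff_subst_monomial {a b c d : ℕ} (h : a + b = c + d) (g : SU2) (r : ℂ) :
    MvPolynomial.coeff (Finsupp.single 0 c + Finsupp.single 1 d)
      (subst g (MvPolynomial.monomial (Finsupp.single 0 a + Finsupp.single 1 b) r)) =
    r * tau a b c g := by
  have hmon : (MvPolynomial.monomial (Finsupp.single 0 a + Finsupp.single 1 b) r :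
      MvPolynomial (Fin 2) ℂ) =
      MvPolynomial.C r * (MvPolynomial.X 0 ^ a * MvPolynomial.X 1 ^ b) := by
    rw [MvPolynomial.X_pow_eq_monomial, MvPolynomial.X_pow_eq_monomial, MvPolynomial.monomial_mul,
      MvPolynomial.C_mul_monomial]
    simp
  have hterm (i j : ℕ) (hi : i ≤ a) (hj : j ≤ b) :
      MvPolynomial.coeff (Finsupp.single 0 c + Finsupp.single 1 d)
        (((MvPolynomial.C (g.1 0 0) * MvPolynomial.X 0) ^ i *
          (MvPolynomial.C (g.1 1 0) * MvPolynomial.X 1) ^ (a - i) * (a.choose i : MvPolynomial (Fin 2) ℂ)) *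
        ((MvPolynomial.C (g.1 0 1) * MvPolynomial.X 0) ^ j *
          (MvPolynomial.C (g.1 1 1) * MvPolynomial.X 1) ^ (b - j) * (b.choose j : MvPolynomial (Fin 2) ℂ))) =
      if i + j = c then (a.choose i * b.choose j : ℂ) *
        (g.1 0 0 ^ i * g.1 1 0 ^ (a - i) * (g.1 0 1 ^ j * g.1 1 1 ^ (b - j))) else 0 := by
    have : ((MvPolynomial.C (g.1 0 0) * MvPolynomial.X 0) ^ i *
          (MvPolynomial.C (g.1 1 0) * MvPolynomial.X 1) ^ (a - i) * (a.choose i : MvPolynomial (Fin 2) ℂ)) *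
        ((MvPolynomial.C (g.1 0 1) * MvPolynomial.X 0) ^ j *
          (MvPolynomial.C (g.1 1 1) * MvPolynomial.X 1) ^ (b - j) * (b.choose j : MvPolynomial (Fin 2) ℂ)) =
        MvPolynomial.C ((a.choose i * b.choose j : ℂ) *
          (g.1 0 0 ^ i * g.1 1 0 ^ (a - i) * (g.1 0 1 ^ j * g.1 1 1 ^ (b - j)))) *
          (MvPolynomial.X 0 ^ (i + j) * MvPolynomial.X 1 ^ (a - i + (b - j))) := by
      simp only [map_mul, map_pow, map_natCast]
      ring
    rw [this, MvPolynomial.X_pow_eq_monomial, MvPolynomial.X_pow_eq_monomial,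
      MvPolynomial.monomial_mul, MvPolynomial.C_mul_monomial, MvPolynomial.coeff_monomial]
    have hiff : (Finsupp.single (0 : Fin 2) (i + j) + Finsupp.single 1 (a - i + (b - j)) =
        Finsupp.single 0 c + Finsupp.single 1 d) ↔ i + j = c := by
      constructor
      · intro h
        simpa using DFunLike.congr_fun h 0
      · intro h1
        rw [h1, show a - i + (b - j) = d by omega]
    simp only [hiff, mul_one]
  rw [hmon, map_mul, map_mul, map_pow, map_pow, subst_X, subst_X, MvPolynomial.algHom_C,
    MvPolynomial.algebraMap_eq, MvPolynomial.coeff_C_mul, Fin.sum_univ_two, Fin.sum_univ_two,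
    add_pow, add_pow, Finset.sum_mul_sum, ← Finset.sum_product', MvPolynomial.coeff_sum]
  congr 1
  rw [Finset.sum_congr rfl fun x hx => hterm x.1 x.2 (by simp at hx; omega) (by simp at hx; omega),
    ← Finset.sum_filter, tau]
  -- The antidiagonal also contains pairs with `x.1 > a` or `x.2 > b`; their binomial coefficients
  -- vanish.
  refine Finset.sum_subset (fun x hx => ?_) fun x hx hx' => ?_
  · simp at hx ⊢
    exact hx.2
  · simp only [Finset.HasAntidiagonal.mem_antidiagonal] at hx
    simp only [Finset.mem_filter, Finset.mem_product, Finset.mem_range, hx, and_true, not_and_or,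
      not_lt] at hx'
    rcases hx' with h1 | h1
    · rw [Nat.choose_eq_zero_of_lt (by omega : a < x.1)]
      simp
    · rw [Nat.choose_eq_zero_of_lt (by omega : b < x.2)]
      simp

theorem basisNorm_ne_zero (ℓ n : ℚ) : basisNorm ℓ n ≠ 0 := by
  unfold basisNorm
  positivity

theorem IsSpinWeight.exists_nat {ℓ m : ℚ} (h : IsSpinWeight ℓ m) :
    ∃ a b : ℕ, (a : ℚ) = ℓ - m ∧ (b : ℚ) = ℓ + m := by
  obtain ⟨⟨N, hN⟩, k, hk, hm⟩ := h
  have hk' : k ≤ N := by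
    have : (k : ℚ) ≤ N := hN ▸ hk
    exact_mod_cast this
  refine ⟨N - k, k, ?_, ?_⟩
  · rw [Nat.cast_sub hk', ← hN, hm]
    ring
  · rw [hm]
    ring

theorem exists_matrixElt_eq {ℓ m n : ℚ} (hm : IsSpinWeight ℓ m) (hn : IsSpinWeight ℓ n) :
    ∃ (a b c d : ℕ) (κ : ℝ), κ ≠ 0 ∧ (a : ℚ) = ℓ - n ∧ (b : ℚ) = ℓ + n ∧ (c : ℚ) = ℓ - m ∧
      (d : ℚ) = ℓ + m ∧ ∀ g, matrixElt ℓ m n g = κ * tau a b c g := by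
  obtain ⟨a, b, ha, hb⟩ := hn.exists_nat
  obtain ⟨c, d, hc, hd⟩ := hm.exists_nat
  refine ⟨a, b, c, d, basisNorm ℓ m * (basisNorm ℓ n)⁻¹,
    mul_ne_zero (basisNorm_ne_zero _ _) (inv_ne_zero (basisNorm_ne_zero _ _)), ha, hb, hc, hd,
    fun g => ?_⟩
  have h : a + b = c + d := by
    have : (a + b : ℚ) = c + d := by rw [ha, hb, hc, hd]; ring
    exact_mod_cast this
  have := coeff_subst_monomial h g ((basisNorm ℓ n : ℂ)⁻¹)
  unfold matrixElt basisVec basisExponent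
  rw [← ha, ← hb, ← hc, ← hd]
  simp only [Nat.floor_natCast]
  change _ * MvPolynomial.coeff _ (subst g _) = _
  rw [this]
  push_cast
  ring

theorem torus_mul_mul_torus (u v : Circle) (g : SU2) :
    (torus u * g * torus v).1 = !![u * v * g.1 0 0, u * (v : ℂ)⁻¹ * g.1 0 1;
      (u : ℂ)⁻¹ * v * g.1 1 0, (u : ℂ)⁻¹ * (v : ℂ)⁻¹ * g.1 1 1] := by
  ext i j
  fin_cases i <;> fin_cases j <;>
    simp [torus, Matrix.mul_apply, Matrix.vecMul, dotProduct, Fin.sum_univ_two] <;> ring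

/-- Every monomial of `tau a b c` has degree `c` in the first row, `a` in the first column and `b`
in the second. For `t^ℓ_{m,n}` the weight is `(-2m, -2n)`. -/
theorem hasWeight_tau (a b c : ℕ) :
    HasWeight (tau a b c) (2 * c - (a + b), (a - b : ℤ)) := by
  intro u v g
  unfold tau
  rw [torus_mul_mul_torus, Finset.mul_sum]
  refine Finset.sum_congr rfl fun x hx => ?_
  rw [Finset.HasAntidiagonal.mem_antidiagonal] at hx
  by_cases h1 : a < x.1
  · simp [Nat.choose_eq_zero_of_lt h1]
  by_cases h2 : b < x.2
  · simp [Nat.choose_eq_zero_of_lt h2]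
  obtain ⟨i, hi⟩ := Nat.exists_eq_add_of_le (not_lt.mp h1)
  obtain ⟨j, hj⟩ := Nat.exists_eq_add_of_le (not_lt.mp h2)
  have hu := Circle.coe_ne_zero u
  have hv := Circle.coe_ne_zero v
  have e1 : (2 * (c : ℤ) - (a + b)) = (x.1 : ℤ) + x.2 - i - j := by omega
  have e2 : (a - b : ℤ) = (x.1 : ℤ) + i - x.2 - j := by omega
  simp only [e1, e2, zpow_sub₀ hu, zpow_sub₀ hv, zpow_add₀ hu, zpow_add₀ hv, zpow_natCast]
  rw [show a - x.1 = i by omega, show b - x.2 = j by omega]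
  simp only [Matrix.of_apply, Matrix.cons_val', Matrix.cons_val_zero, Matrix.cons_val_one,
    Matrix.cons_val_fin_one, mul_pow, inv_pow]
  field_simp

/-! ### Entries of an element of `SU(2)` -/

theorem star_eq_adjugate (g : SU2) : star g.1 = g.1.adjugate := by
  obtain ⟨h1, h2⟩ := Matrix.mem_specialUnitaryGroup_iff.mp g.2
  rw [Matrix.mem_unitaryGroup_iff] at h1
  calc star g.1 = g.1.adjugate * g.1 * star g.1 := by
        rw [Matrix.adjugate_mul, h2, one_smul, one_mul]
    _ = g.1.adjugate := by rw [mul_assoc, h1, mul_one]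

theorem entry_one_one (g : SU2) : g.1 1 1 = starRingEnd ℂ (g.1 0 0) := by
  have := congrFun (congrFun (star_eq_adjugate g) 0) 0
  simpa [Matrix.star_apply, Matrix.adjugate_fin_two] using this.symm

theorem entry_one_zero (g : SU2) : g.1 1 0 = -starRingEnd ℂ (g.1 0 1) := by
  have := congrFun (congrFun (star_eq_adjugate g) 1) 0
  simp [Matrix.star_apply, Matrix.adjugate_fin_two] at this
  rw [this, neg_neg]

theorem normSq_add_normSq (g : SU2) :
    Complex.normSq (g.1 0 0) + Complex.normSq (g.1 0 1) = 1 := by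
  have h2 := (Matrix.mem_specialUnitaryGroup_iff.mp g.2).2
  rw [Matrix.det_fin_two, entry_one_one, entry_one_zero, Complex.mul_conj, mul_neg,
    Complex.mul_conj, sub_neg_eq_add] at h2
  exact_mod_cast h2

/-- The real matrix with rows `(x, y)` and `(-y, x)`, for `x ^ 2 + y ^ 2 = 1`. -/
noncomputable def rot (x y : ℝ) (h : x ^ 2 + y ^ 2 = 1) : SU2 :=
  ⟨!![(x : ℂ), y; -y, x], by
    have h' : (x : ℂ) ^ 2 + (y : ℂ) ^ 2 = 1 := by exact_mod_cast h
    rw [Matrix.mem_specialUnitaryGroup_iff, Matrix.mem_unitaryGroup_iff]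
    constructor
    · ext i j
      fin_cases i <;> fin_cases j <;>
        simp [Matrix.mul_apply, Fin.sum_univ_two, Matrix.star_apply] <;>
        first | linear_combination h' | ring
    · rw [Matrix.det_fin_two_of]
      linear_combination h'⟩

/-- The Cartan decomposition. The torus angles add up to the argument of `α` and differ by that of
`β`, whence the half sum and half difference; the first row determines the matrix. -/
theorem exists_eq_torus_mul_rot_mul_torus (g : SU2) :
    ∃ (u v : Circle) (x y : ℝ) (h : x ^ 2 + y ^ 2 = 1), g = torus u * rot x y h * torus v := by
  set α := g.1 0 0 with hα
  set β := g.1 0 1 with hβ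
  have h : ‖α‖ ^ 2 + ‖β‖ ^ 2 = 1 := by
    rw [← Complex.normSq_eq_norm_sq, ← Complex.normSq_eq_norm_sq]
    exact normSq_add_normSq g
  refine ⟨Circle.exp ((α.arg + β.arg) / 2), Circle.exp ((α.arg - β.arg) / 2), ‖α‖, ‖β‖, h, ?_⟩
  have e00 : ∀ z : ℂ, (‖z‖ : ℂ) * Complex.exp (z.arg * Complex.I) = z :=
    Complex.norm_mul_exp_arg_mul_I
  have h00 : (Circle.exp ((α.arg + β.arg) / 2) : ℂ) * Circle.exp ((α.arg - β.arg) / 2) * ‖α‖ = α := by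
    conv_rhs => rw [← e00 α]
    rw [Circle.coe_exp, Circle.coe_exp, ← Complex.exp_add, mul_comm]
    congr 2
    push_cast
    ring
  have h01 : (Circle.exp ((α.arg + β.arg) / 2) : ℂ) * (Circle.exp ((α.arg - β.arg) / 2) : ℂ)⁻¹ * ‖β‖ = β := by
    conv_rhs => rw [← e00 β]
    rw [Circle.coe_exp, Circle.coe_exp, ← Complex.exp_neg, ← Complex.exp_add, mul_comm]
    congr 2
    push_cast
    ring
  set k := torus (Circle.exp ((α.arg + β.arg) / 2)) * rot ‖α‖ ‖β‖ h *
    torus (Circle.exp ((α.arg - β.arg) / 2)) with hk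
  have k00 : k.1 0 0 = α := by
    rw [hk, torus_mul_mul_torus]
    simpa [rot] using h00
  have k01 : k.1 0 1 = β := by
    rw [hk, torus_mul_mul_torus]
    simpa [rot] using h01
  ext i j
  fin_cases i <;> fin_cases j
  · exact k00.symm
  · exact k01.symm
  · change g.1 1 0 = k.1 1 0
    rw [entry_one_zero, entry_one_zero, k01]
  · change g.1 1 1 = k.1 1 1
    rw [entry_one_one, entry_one_one, k00]

end SU2

namespace SU2

/-! ### Matrix elements on real rotations -/

/-- The polynomial in `t` to which `tau a b c` restricts, up to a positive factor, on the real
rotations with first row proportional to `(t, 1)`. -/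
noncomputable def rotPoly (a b c : ℕ) : Polynomial ℝ :=
  ∑ x ∈ Finset.HasAntidiagonal.antidiagonal c,
    Polynomial.monomial (x.1 + (b - x.2)) ((a.choose x.1 * b.choose x.2 : ℝ) * (-1) ^ (a - x.1))

/-- Nonzero terms have distinct exponents, so nothing cancels; the term with `x.1 = min a c` is
nonzero. -/
theorem rotPoly_ne_zero {a b c : ℕ} (h : c ≤ a + b) : rotPoly a b c ≠ 0 := by
  intro h0
  have hcoeff := congrArg (fun p => Polynomial.coeff p (min a c + (b - (c - min a c)))) h0
  simp only [rotPoly, Polynomial.finsetSum_coeff, Polynomial.coeff_monomial,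
    Polynomial.coeff_zero] at hcoeff
  rw [Finset.sum_eq_single (min a c, c - min a c)] at hcoeff
  · rw [if_pos rfl] at hcoeff
    have h1 : (a.choose (min a c) : ℝ) ≠ 0 := by
      exact_mod_cast (Nat.choose_pos (min_le_left a c)).ne'
    have h2 : (b.choose (c - min a c) : ℝ) ≠ 0 := by
      exact_mod_cast (Nat.choose_pos (by omega)).ne'
    simp [h1, h2] at hcoeff
  · intro x hx hne
    rw [Finset.HasAntidiagonal.mem_antidiagonal] at hx
    by_cases h1 : a < x.1
    · simp [Nat.choose_eq_zero_of_lt h1]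
    by_cases h2 : b < x.2
    · simp [Nat.choose_eq_zero_of_lt h2]
    rw [if_neg]
    intro h3
    apply hne
    ext <;> simp only <;> omega
  · intro h1
    exact absurd (Finset.HasAntidiagonal.mem_antidiagonal.mpr (by simp)) h1

theorem exists_tau_rot_eq_ofReal (a b c : ℕ) (x y : ℝ) (h : x ^ 2 + y ^ 2 = 1) :
    ∃ r : ℝ, tau a b c (rot x y h) = r := by
  refine ⟨∑ z ∈ Finset.HasAntidiagonal.antidiagonal c, (a.choose z.1 * b.choose z.2 : ℝ) *
    (x ^ z.1 * (-y) ^ (a - z.1) * (y ^ z.2 * x ^ (b - z.2))), ?_⟩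
  simp [tau, rot]

theorem sq_div_sqrt_add (t : ℝ) : (t / √(1 + t ^ 2)) ^ 2 + (1 / √(1 + t ^ 2)) ^ 2 = 1 := by
  have h : 0 < 1 + t ^ 2 := by positivity
  rw [div_pow, div_pow, Real.sq_sqrt h.le]
  field_simp
  ring

theorem tau_rot_eq (a b c : ℕ) (t : ℝ) :
    tau a b c (rot _ _ (sq_div_sqrt_add t)) =
      ((1 / √(1 + t ^ 2)) ^ (a + b) * (rotPoly a b c).eval t : ℝ) := by
  rw [rotPoly, Polynomial.eval_finsetSum, Finset.mul_sum]
  simp only [tau, rot, Matrix.of_apply, Matrix.cons_val', Matrix.cons_val_zero,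
    Matrix.cons_val_one, Matrix.cons_val_fin_one, Complex.ofReal_sum, Polynomial.eval_monomial]
  refine Finset.sum_congr rfl fun x hx => ?_
  by_cases h1 : a < x.1
  · simp [Nat.choose_eq_zero_of_lt h1]
  by_cases h2 : b < x.2
  · simp [Nat.choose_eq_zero_of_lt h2]
  obtain ⟨i, hi⟩ := Nat.exists_eq_add_of_le (not_lt.mp h1)
  obtain ⟨j, hj⟩ := Nat.exists_eq_add_of_le (not_lt.mp h2)
  rw [show a - x.1 = i by omega, show b - x.2 = j by omega,
    show a + b = x.1 + i + (x.2 + j) by omega, neg_pow, div_eq_mul_one_div t]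
  push_cast
  simp only [mul_pow, pow_add]
  ring

theorem exists_tau_ne_zero {a b c a' b' c' : ℕ} (h : c ≤ a + b) (h' : c' ≤ a' + b') :
    ∃ g, tau a b c g ≠ 0 ∧ tau a' b' c' g ≠ 0 := by
  obtain ⟨t, ht⟩ : ∃ t : ℝ, (rotPoly a b c * rotPoly a' b' c').eval t ≠ 0 := by
    by_contra! hall
    exact mul_ne_zero (rotPoly_ne_zero h) (rotPoly_ne_zero h')
      (Polynomial.funext fun t => by simpa using hall t)
  rw [Polynomial.eval_mul] at ht
  have hs : (1 / √(1 + t ^ 2)) ≠ 0 := by positivity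
  refine ⟨rot _ _ (sq_div_sqrt_add t), ?_, ?_⟩ <;> rw [tau_rot_eq] <;> norm_cast
  · exact mul_ne_zero (pow_ne_zero _ hs) (left_ne_zero_of_mul ht)
  · exact mul_ne_zero (pow_ne_zero _ hs) (right_ne_zero_of_mul ht)

/-- A function of weight zero is determined by its values on real rotations, where `tau` is real.
The product is therefore real everywhere, and its square is nonnegative and somewhere positive. -/
theorem integral_sq_tau_mul_tau_ne_zero {a b c a' b' c' m n : ℕ} (h : c ≤ a + b)
    (h' : c' ≤ a' + b') (hw : HasWeight (fun g => tau a b c g ^ m * tau a' b' c' g ^ n) 0) :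
    ∫ g, (tau a b c g ^ m * tau a' b' c' g ^ n) ^ 2 ∂haar ≠ 0 := by
  set F : SU2 → ℂ := fun g => tau a b c g ^ m * tau a' b' c' g ^ n with hF
  have hcont : Continuous F := ((continuous_tau _ _ _).pow _).mul ((continuous_tau _ _ _).pow _)
  have hreal (g : SU2) : F g = ((F g).re : ℂ) := by
    obtain ⟨u, v, x, y, hxy, rfl⟩ := exists_eq_torus_mul_rot_mul_torus g
    rw [hw u v]
    obtain ⟨r, hr⟩ := exists_tau_rot_eq_ofReal a b c x y hxy
    obtain ⟨s, hs⟩ := exists_tau_rot_eq_ofReal a' b' c' x y hxy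
    have : F (rot x y hxy) = ((r ^ m * s ^ n : ℝ) : ℂ) := by
      simp only [hF, hr, hs]
      push_cast
      rfl
    simp only [Prod.fst_zero, Prod.snd_zero, zpow_zero, one_mul, this, Complex.ofReal_re]
  obtain ⟨g, hg, hg'⟩ := exists_tau_ne_zero h h'
  have hFg : F g ≠ 0 := mul_ne_zero (pow_ne_zero _ hg) (pow_ne_zero _ hg')
  have hpos : 0 < ∫ g, (F g).re ^ 2 ∂haar := by
    refine Continuous.integral_pos_of_hasCompactSupport_nonneg_nonzero (x := g)
      ((Complex.continuous_re.comp hcont).pow 2) (HasCompactSupport.of_compactSpace _)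
      (fun g => sq_nonneg _) ?_
    refine pow_ne_zero 2 fun h0 => hFg ?_
    rw [hreal g, h0, Complex.ofReal_zero]
  have heq : ∫ g, F g ^ 2 ∂haar = ((∫ g, (F g).re ^ 2 ∂haar : ℝ) : ℂ) := by
    rw [← integral_complex_ofReal]
    refine integral_congr_ae (.of_forall fun g => ?_)
    simp only [Complex.ofReal_pow]
    rw [← hreal g]
  rw [heq]
  exact_mod_cast hpos.ne'

/-! ### Powers of a sum of two functions with weights -/

section Sum

variable {F₁ F₂ : SU2 → ℂ} {w₁ w₂ : ℤ × ℤ}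

theorem integral_add_pow_mul (h₁ : Continuous F₁) (h₂ : Continuous F₂) {h : SU2 → ℂ}
    (hh : Continuous h) (P : ℕ) :
    ∫ g, (F₁ g + F₂ g) ^ P * h g ∂haar =
      ∑ m ∈ Finset.range (P + 1), (P.choose m : ℂ) * ∫ g, F₁ g ^ m * F₂ g ^ (P - m) * h g ∂haar := by
  have (g : SU2) : (F₁ g + F₂ g) ^ P * h g =
      ∑ m ∈ Finset.range (P + 1), (P.choose m : ℂ) * (F₁ g ^ m * F₂ g ^ (P - m) * h g) := by
    rw [add_pow, Finset.sum_mul]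
    exact Finset.sum_congr rfl fun m _ => by ring
  simp only [this]
  rw [integral_finsetSum]
  · simp only [integral_const_mul]
  · exact fun m _ => integrable_of_continuous (by fun_prop)

theorem exists_forall_integral_eq_zero (h₁ : Continuous F₁) (h₂ : Continuous F₂)
    (hw₁ : HasWeight F₁ w₁) (hw₂ : HasWeight F₂ w₂)
    (hne : ∀ m n : ℕ, m • w₁ + n • w₂ = 0 → m = 0 ∧ n = 0) {h : SU2 → ℂ} (hh : IsGFinite h) :
    ∃ P₀ : ℕ, ∀ P : ℕ, P₀ ≤ P → ∫ g, (F₁ g + F₂ g) ^ P * h g ∂haar = 0 := by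
  obtain ⟨S, hS, hzero⟩ := exists_finite_weights hh
  have hfib (s : ℤ × ℤ) : {p : ℕ × ℕ | p.1 • w₁ + p.2 • w₂ = s}.Finite := by
    -- The difference of two comparable pairs in a fibre is a relation, so fibres are antichains in
    -- `ℕ × ℕ`, hence finite.
    refine WellQuasiOrderedLE.finite_of_isAntichain fun p hp q hq hpq hle => hpq ?_
    obtain ⟨i, hi⟩ := Nat.exists_eq_add_of_le hle.1
    obtain ⟨j, hj⟩ := Nat.exists_eq_add_of_le hle.2
    have hp' : p.1 • w₁ + p.2 • w₂ = s := hp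
    have hq' : q.1 • w₁ + q.2 • w₂ = s := hq
    have : i • w₁ + j • w₂ = 0 := by
      rw [hi, hj, add_smul, add_smul] at hq'
      rw [← hp'] at hq'
      rw [add_add_add_comm] at hq'
      exact left_eq_add.mp hq'.symm
    obtain ⟨rfl, rfl⟩ := hne i j this
    exact Prod.ext (by simp [hi]) (by simp [hj])
  have hT : {p : ℕ × ℕ | p.1 • w₁ + p.2 • w₂ ∈ S}.Finite := by
    have : {p : ℕ × ℕ | p.1 • w₁ + p.2 • w₂ ∈ S} =
        ⋃ s ∈ S, {p : ℕ × ℕ | p.1 • w₁ + p.2 • w₂ = s} := by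
      ext p
      simp
    rw [this]
    exact hS.biUnion fun s _ => hfib s
  obtain ⟨B, hB⟩ := (hT.image fun p => p.1 + p.2).bddAbove
  refine ⟨B + 1, fun P hP => ?_⟩
  rw [integral_add_pow_mul h₁ h₂ hh.1]
  refine Finset.sum_eq_zero fun m hm => ?_
  rw [hzero (fun g => F₁ g ^ m * F₂ g ^ (P - m)) (m • w₁ + (P - m) • w₂) (by fun_prop)
    ((hw₁.pow m).mul (hw₂.pow (P - m))), mul_zero]
  intro hmem
  have := hB ⟨(m, P - m), hmem, rfl⟩
  simp only [Finset.mem_range] at hm this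
  omega

/-- The relation forces `w₁ ≠ w₂`, so the weights of the terms of a fixed power are distinct. In the
power `2 * (m + n)` only the term `k = 2 * m` has weight zero; the doubling makes it a square. -/
theorem exists_integral_pow_ne_zero (h₁ : Continuous F₁) (h₂ : Continuous F₂)
    (hw₁ : HasWeight F₁ w₁) (hw₂ : HasWeight F₂ w₂) (hw : w₁ ≠ 0 ∨ w₂ ≠ 0) {m n : ℕ}
    (hmn : m • w₁ + n • w₂ = 0) (hpos : 0 < m + n)
    (hint : ∫ g, (F₁ g ^ m * F₂ g ^ n) ^ 2 ∂haar ≠ 0) :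
    ∃ P : ℕ, 0 < P ∧ ∫ g, (F₁ g + F₂ g) ^ P ∂haar ≠ 0 := by
  have hww : w₁ ≠ w₂ := by
    rintro rfl
    rw [← add_smul] at hmn
    rcases smul_eq_zero.mp hmn with h0 | h0
    · omega
    · simp [h0] at hw
  refine ⟨2 * (m + n), by omega, ?_⟩
  have key := integral_add_pow_mul h₁ h₂ (h := fun _ => 1) continuous_const (2 * (m + n))
  simp only [mul_one] at key
  rw [key, Finset.sum_eq_single (2 * m)]
  · refine mul_ne_zero (by exact_mod_cast (Nat.choose_pos (by omega)).ne') ?_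
    rw [show 2 * (m + n) - 2 * m = n * 2 by omega, mul_comm 2 m]
    simpa only [mul_pow, ← pow_mul] using hint
  · intro k hk hne
    rw [((hw₁.pow k).mul (hw₂.pow (2 * (m + n) - k))).integral_eq_zero, mul_zero]
    intro h0
    have hk' : k ≤ 2 * (m + n) := by
      simp only [Finset.mem_range] at hk
      omega
    obtain ⟨l, hl⟩ := Nat.exists_eq_add_of_le hk'
    rw [hl, Nat.add_sub_cancel_left] at h0
    apply hww
    have h1 : ((k : ℤ) - 2 * m) • (w₁ - w₂) = 0 := by
      have hl' : (k : ℤ) = 2 * (m + n) - l := by omega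
      have e1 : (k : ℤ) • w₁ + (l : ℤ) • w₂ = 0 := by simpa using h0
      have e2 : (m : ℤ) • w₁ + (n : ℤ) • w₂ = 0 := by simpa using hmn
      have e3 : (l : ℤ) = 2 * (m + n) - k := by omega
      rw [e3] at e1
      linear_combination e1 - (2 : ℤ) • e2
    rcases smul_eq_zero.mp h1 with h2 | h2
    · omega
    · exact sub_eq_zero.mp h2
  · intro h0
    simp only [Finset.mem_range] at h0
    omega

end Sum

end SU2


/-! ### Primes that are invertible in `ℤ[z]` -/

theorem exists_isIntegral_pow_mul {z : ℂ} {y : ℤ} (hy : IsIntegral ℤ ((y : ℂ) * z)) {r : ℂ}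
    (hr : r ∈ Algebra.adjoin ℤ {z}) : ∃ m : ℕ, IsIntegral ℤ ((y : ℂ) ^ m * r) := by
  have hyi (m : ℕ) : IsIntegral ℤ ((y : ℂ) ^ m) :=
    (isIntegral_algebraMap (R := ℤ) (A := ℂ) (x := y)).pow m
  induction hr using Algebra.adjoin_induction with
  | mem x hx =>
    rw [Set.mem_singleton_iff.mp hx]
    exact ⟨1, by simpa using hy⟩
  | algebraMap k => exact ⟨0, by simpa using isIntegral_algebraMap (R := ℤ) (A := ℂ) (x := k)⟩
  | add a b _ _ ha hb =>
    obtain ⟨m, hm⟩ := ha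
    obtain ⟨n, hn⟩ := hb
    refine ⟨m + n, ?_⟩
    have : (y : ℂ) ^ (m + n) * (a + b) = y ^ n * (y ^ m * a) + y ^ m * (y ^ n * b) := by ring
    rw [this]
    exact ((hyi n).mul hm).add ((hyi m).mul hn)
  | mul a b _ _ ha hb =>
    obtain ⟨m, hm⟩ := ha
    obtain ⟨n, hn⟩ := hb
    refine ⟨m + n, ?_⟩
    have : (y : ℂ) ^ (m + n) * (a * b) = (y ^ m * a) * (y ^ n * b) := by ring
    rw [this]
    exact hm.mul hn

/-- If `z` is algebraic and `y * z` is integral, `1 / p ∈ ℤ[z]` makes `y ^ m / p` a rational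
algebraic integer, so `p ∣ y`. If `z` is transcendental, `p * u(z) = 1` is impossible, since `p * u
- 1` has nonzero constant term. -/
theorem exists_bound_invertible_primes (z : ℂ) :
    ∃ B : ℕ, ∀ p : ℕ, p.Prime → B < p → ∀ r ∈ Algebra.adjoin ℤ {z}, (p : ℂ) * r ≠ 1 := by
  by_cases hz : IsAlgebraic ℤ z
  · obtain ⟨y, hy0, hy⟩ := hz.exists_integral_multiple
    rw [zsmul_eq_mul] at hy
    refine ⟨y.natAbs, fun p hp hlt r hr h1 => ?_⟩
    obtain ⟨m, hm⟩ := exists_isIntegral_pow_mul hy hr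
    have hp0 : (p : ℂ) ≠ 0 := by exact_mod_cast hp.ne_zero
    have hq : algebraMap ℚ ℂ ((y : ℚ) ^ m / p) = (y : ℂ) ^ m * r := by
      rw [eq_inv_of_mul_eq_one_right h1, map_div₀, map_pow]
      simp [div_eq_mul_inv]
    rw [← hq, isIntegral_algebraMap_iff (algebraMap ℚ ℂ).injective,
      IsIntegrallyClosed.isIntegral_iff] at hm
    obtain ⟨k, hk⟩ := hm
    have hp0' : (p : ℚ) ≠ 0 := by exact_mod_cast hp.ne_zero
    rw [eq_div_iff hp0'] at hk
    have hk' : k * p = y ^ m := by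
      have hk'' : (k : ℚ) * p = (y : ℚ) ^ m := by simpa using hk
      exact_mod_cast hk''
    have hdvd : (p : ℤ) ∣ y := (Nat.prime_iff_prime_int.mp hp).dvd_of_dvd_pow
      (Dvd.intro_left k hk')
    have := Nat.le_of_dvd (Int.natAbs_pos.mpr hy0) (Int.natCast_dvd.mp hdvd)
    omega
  · refine ⟨0, fun p hp _ r hr h1 => hz ?_⟩
    rw [Algebra.adjoin_singleton_eq_range_aeval] at hr
    obtain ⟨u, rfl⟩ := hr
    refine ⟨Polynomial.C (p : ℤ) * u - 1, fun h0 => ?_, ?_⟩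
    · have := congrArg (fun q => Polynomial.coeff q 0) h0
      simp only [Polynomial.coeff_sub, Polynomial.coeff_C_mul, Polynomial.coeff_one_zero,
        Polynomial.coeff_zero] at this
      have h2 : (p : ℤ) ∣ 1 := ⟨_, (sub_eq_zero.mp this).symm⟩
      exact (Nat.prime_iff_prime_int.mp hp).not_dvd_one h2
    · rw [map_sub, map_mul, map_one, Polynomial.aeval_C]
      simpa [sub_eq_zero] using h1

/-- If the leading coefficient of `q` is an integer prime to `p`, and `p - 1` is a multiple of the
degree, then vanishing of the integral over `[0, 1]` of a suitable power of `q` makes `p` invertible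
in any ring containing the coefficients of `q`. -/
theorem exists_mul_eq_one_of_sum_eq_zero {R : Subalgebra ℤ ℂ} {q : Polynomial R} {N P p : ℕ}
    (hp : p.Prime) (hN : q.natDegree ≤ N) (hPp : N * P + 1 = p) {L : ℤ}
    (hL : q.coeff N = algebraMap ℤ R L) (hLp : ¬ (p : ℤ) ∣ L)
    (hsum : ∑ k ∈ Finset.range p, ((q ^ P).coeff k : ℂ) / (k + 1) = 0) :
    ∃ r ∈ R, (p : ℂ) * r = 1 := by
  have htop : ((q ^ P).coeff (N * P) : ℂ) = (L : ℂ) ^ P := by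
    rw [mul_comm, Polynomial.coeff_pow_of_natDegree_le hN, hL]
    simp
  -- The factor `(N * P)!` clears every denominator except that of the top term, which is `p`.
  set s : ℂ := ∑ k ∈ Finset.range (N * P), ((q ^ P).coeff k : ℂ) * ((N * P).factorial / (k + 1) : ℕ)
    with hs
  have hsR : s ∈ R := Subalgebra.sum_mem _ fun k _ =>
    Subalgebra.mul_mem _ (SetLike.coe_mem _) (Subalgebra.natCast_mem _ _)
  have hrel : (p : ℂ) * s + (L : ℂ) ^ P * (N * P).factorial = 0 := by
    rw [← hPp, Finset.sum_range_succ, htop] at hsum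
    have hne : ((N * P : ℕ) : ℂ) + 1 ≠ 0 := by exact_mod_cast Nat.succ_ne_zero (N * P)
    have h1 : s = (N * P).factorial *
        ∑ k ∈ Finset.range (N * P), ((q ^ P).coeff k : ℂ) / (k + 1) := by
      rw [hs, Finset.mul_sum]
      refine Finset.sum_congr rfl fun k hk => ?_
      have hdvd : k + 1 ∣ (N * P).factorial :=
        Nat.dvd_factorial (Nat.succ_pos k) (by simpa using hk)
      have hk1 : ((k + 1 : ℕ) : ℂ) ≠ 0 := by exact_mod_cast Nat.succ_ne_zero k
      rw [Nat.cast_div hdvd hk1]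
      push_cast
      ring
    rw [eq_neg_of_add_eq_zero_left hsum] at h1
    rw [h1, ← hPp]
    push_cast at hne ⊢
    field_simp
    ring
  have hcop : IsCoprime (p : ℤ) (L ^ P * (N * P).factorial) := by
    have hpi := Nat.prime_iff_prime_int.mp hp
    rw [hpi.irreducible.coprime_iff_not_dvd]
    intro h
    rcases hpi.dvd_or_dvd h with h | h
    · exact hLp (hpi.dvd_of_dvd_pow h)
    · have := (hp.dvd_factorial).mp (Int.natCast_dvd_natCast.mp h)
      omega
  obtain ⟨a, b, hab⟩ := hcop
  refine ⟨a - b * s, Subalgebra.sub_mem _ (Subalgebra.intCast_mem _ _)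
    (Subalgebra.mul_mem _ (Subalgebra.intCast_mem _ _) hsR), ?_⟩
  have hab' : (a : ℂ) * p + b * ((L : ℂ) ^ P * (N * P).factorial) = 1 := by exact_mod_cast hab
  linear_combination hab' - b * hrel

namespace SU2

/-! ### Moments of `|α| ^ 2` -/

theorem hasWeight_entry_zero_zero : HasWeight (fun g => g.1 0 0) (1, 1) := fun u v g => by
  simp only [torus_mul_mul_torus]
  simp

theorem hasWeight_entry_zero_one : HasWeight (fun g => g.1 0 1) (1, -1) := fun u v g => by
  simp only [torus_mul_mul_torus]
  simp

theorem hasWeight_entry_one_zero : HasWeight (fun g => g.1 1 0) (-1, 1) := fun u v g => by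
  simp only [torus_mul_mul_torus]
  simp

theorem hasWeight_entry_one_one : HasWeight (fun g => g.1 1 1) (-1, -1) := fun u v g => by
  simp only [torus_mul_mul_torus]
  simp

theorem det_eq_one (g : SU2) : g.1 0 0 * g.1 1 1 - g.1 0 1 * g.1 1 0 = 1 := by
  rw [← Matrix.det_fin_two]
  exact (Matrix.mem_specialUnitaryGroup_iff.mp g.2).2

/-- Right translation by a rotation replaces `α` and `δ` by multiples of `t * α - β` and `t * δ +
γ`. After expansion the weights kill all but the diagonal terms, and `1 - α * δ = -β * γ`. -/
theorem integral_binomial_eq (N : ℕ) (t : ℝ) :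
    (1 + (t : ℂ) ^ 2) ^ N * ∫ g : SU2, (g.1 0 0 * g.1 1 1) ^ N ∂haar =
      ∑ i ∈ Finset.range (N + 1), (N.choose i : ℂ) ^ 2 * ((t : ℂ) ^ 2) ^ i *
        ∫ g : SU2, (g.1 0 0 * g.1 1 1) ^ i * (1 - g.1 0 0 * g.1 1 1) ^ (N - i) ∂haar := by
  have h00 := continuous_entry 0 0
  have h01 := continuous_entry 0 1
  have h10 := continuous_entry 1 0
  have h11 := continuous_entry 1 1
  have hs : (1 + (t : ℂ) ^ 2) ≠ 0 := by
    exact_mod_cast (by positivity : (1 + t ^ 2 : ℝ) ≠ 0)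
  have hsq : ((√(1 + t ^ 2) : ℝ) : ℂ) ^ 2 = 1 + (t : ℂ) ^ 2 := by
    rw [← Complex.ofReal_pow, Real.sq_sqrt (by positivity)]
    push_cast
    rfl
  have hs0 : ((√(1 + t ^ 2) : ℝ) : ℂ) ≠ 0 := by
    intro h
    rw [h] at hsq
    exact hs (by simpa using hsq.symm)
  have hrot (g : SU2) : (1 + (t : ℂ) ^ 2) * ((g * rot _ _ (sq_div_sqrt_add t)).1 0 0 *
      (g * rot _ _ (sq_div_sqrt_add t)).1 1 1) =
      (t * g.1 0 0 + -g.1 0 1) * (t * g.1 1 1 + g.1 1 0) := by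
    rw [← hsq]
    simp [rot, Matrix.mul_apply, Fin.sum_univ_two]
    field_simp
    ring
  rw [← integral_mul_right_eq_self (fun g : SU2 => (g.1 0 0 * g.1 1 1) ^ N)
    (rot _ _ (sq_div_sqrt_add t)), ← integral_const_mul]
  have hexp (g : SU2) : (1 + (t : ℂ) ^ 2) ^ N * ((g * rot _ _ (sq_div_sqrt_add t)).1 0 0 *
      (g * rot _ _ (sq_div_sqrt_add t)).1 1 1) ^ N =
      ∑ i ∈ Finset.range (N + 1), ∑ j ∈ Finset.range (N + 1),
        ((N.choose i : ℂ) * N.choose j * t ^ i * t ^ j * (-1) ^ (N - i)) *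
        ((g.1 0 0 ^ i * g.1 0 1 ^ (N - i)) * (g.1 1 1 ^ j * g.1 1 0 ^ (N - j))) := by
    rw [← mul_pow, hrot, mul_pow, add_pow, add_pow, Finset.sum_mul_sum]
    refine Finset.sum_congr rfl fun i _ => Finset.sum_congr rfl fun j _ => ?_
    rw [mul_pow, mul_pow, neg_pow]
    ring
  have hcont (i j : ℕ) : Continuous fun g : SU2 =>
      ((N.choose i : ℂ) * N.choose j * t ^ i * t ^ j * (-1) ^ (N - i)) *
        ((g.1 0 0 ^ i * g.1 0 1 ^ (N - i)) * (g.1 1 1 ^ j * g.1 1 0 ^ (N - j))) :=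
    continuous_const.mul
      (((h00.pow i).mul (h01.pow _)).mul ((h11.pow j).mul (h10.pow _)))
  simp only [hexp]
  rw [integral_finsetSum]
  swap
  · exact fun i _ => integrable_of_continuous (continuous_finsetSum _ fun j _ => hcont i j)
  refine Finset.sum_congr rfl fun i hi => ?_
  rw [integral_finsetSum]
  swap
  · exact fun j _ => integrable_of_continuous (hcont i j)
  rw [Finset.sum_eq_single i]
  · rw [← integral_const_mul]
    refine integral_congr_ae (.of_forall fun g => ?_)
    have hdet : 1 - g.1 0 0 * g.1 1 1 = -1 * (g.1 0 1 * g.1 1 0) := by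
      linear_combination -det_eq_one g
    simp only
    rw [hdet, mul_pow, mul_pow, mul_pow]
    ring
  · intro j hj hji
    rw [((((hasWeight_entry_zero_zero.pow i).mul (hasWeight_entry_zero_one.pow (N - i))).mul
      ((hasWeight_entry_one_one.pow j).mul (hasWeight_entry_one_zero.pow (N - j)))).const_mul
      _).integral_eq_zero]
    intro h0
    have h2 := congrArg Prod.snd h0
    simp only [Finset.mem_range] at hi hj
    simp at h2
    omega
  · exact fun h => absurd hi h

theorem integral_entry_pow (N : ℕ) :
    ∫ g : SU2, (g.1 0 0 * g.1 1 1) ^ N ∂haar = 1 / (N + 1) := by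
  set M := ∫ g : SU2, (g.1 0 0 * g.1 1 1) ^ N ∂haar with hM
  set m : ℕ → ℂ := fun i =>
    ∫ g : SU2, (g.1 0 0 * g.1 1 1) ^ i * (1 - g.1 0 0 * g.1 1 1) ^ (N - i) ∂haar with hm
  have hpoly : (1 + Polynomial.X) ^ N * Polynomial.C M =
      ∑ i ∈ Finset.range (N + 1), Polynomial.monomial i ((N.choose i : ℂ) ^ 2 * m i) := by
    refine Polynomial.eq_of_infinite_eval_eq _ _ (Set.Infinite.mono
      (s := Set.range fun n : ℕ => (n : ℂ) ^ 2) ?_ (Set.infinite_range_of_injective ?_))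
    · rintro _ ⟨n, rfl⟩
      have := integral_binomial_eq N n
      simp only [Set.mem_ofPred_eq, Polynomial.eval_mul, Polynomial.eval_pow, Polynomial.eval_add,
        Polynomial.eval_one, Polynomial.eval_X, Polynomial.eval_C, Polynomial.eval_finsetSum,
        Polynomial.eval_monomial]
      push_cast at this
      rw [this]
      exact Finset.sum_congr rfl fun i _ => by ring
    · intro a b hab
      have : a ^ 2 = b ^ 2 := by
        simp only at hab
        exact_mod_cast hab
      exact Nat.pow_left_injective two_ne_zero this
  -- Comparing coefficients of `t ^ 2` makes `N.choose i * m i` independent of `i`. These `N + 1`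
  -- numbers sum to one, by the binomial theorem.
  have hcoeff (i : ℕ) (hi : i ∈ Finset.range (N + 1)) : (N.choose i : ℂ) * m i = M := by
    have h1 := congrArg (fun p => Polynomial.coeff p i) hpoly
    simp only [Polynomial.coeff_mul_C, Polynomial.coeff_one_add_X_pow, Polynomial.finsetSum_coeff,
      Polynomial.coeff_monomial, Finset.sum_ite_eq', if_pos hi] at h1
    have h2 : (N.choose i : ℂ) ≠ 0 := by
      simp only [Finset.mem_range] at hi
      exact_mod_cast (Nat.choose_pos (by omega)).ne'
    apply mul_left_cancel₀ h2
    linear_combination -h1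
  have hone : ∑ i ∈ Finset.range (N + 1), (N.choose i : ℂ) * m i = 1 := by
    have hx := (continuous_entry 0 0).mul (continuous_entry 1 1)
    simp only [hm, ← integral_const_mul]
    rw [← integral_finsetSum]
    swap
    · exact fun i _ => integrable_of_continuous
        (continuous_const.mul ((hx.pow i).mul ((continuous_const.sub hx).pow _)))
    have (g : SU2) : ∑ i ∈ Finset.range (N + 1), (N.choose i : ℂ) *
        ((g.1 0 0 * g.1 1 1) ^ i * (1 - g.1 0 0 * g.1 1 1) ^ (N - i)) = 1 := by
      have h := add_pow (g.1 0 0 * g.1 1 1) (1 - g.1 0 0 * g.1 1 1) N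
      rw [add_sub_cancel, one_pow] at h
      exact (Finset.sum_congr rfl fun i _ => mul_comm _ _).trans h.symm
    simp [this]
  rw [Finset.sum_congr rfl hcoeff, Finset.sum_const, Finset.card_range, nsmul_eq_mul] at hone
  have hN : ((N : ℂ) + 1) ≠ 0 := by exact_mod_cast Nat.succ_ne_zero N
  push_cast at hone
  rw [eq_div_iff hN]
  linear_combination hone

theorem integral_eval (q : Polynomial ℂ) {n : ℕ} (hn : q.natDegree < n) :
    ∫ g : SU2, q.eval (g.1 0 0 * g.1 1 1) ∂haar =
      ∑ k ∈ Finset.range n, q.coeff k / (k + 1) := by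
  have hx := (continuous_entry 0 0).mul (continuous_entry 1 1)
  simp only [Polynomial.eval_eq_sum_range' hn]
  rw [integral_finsetSum]
  swap
  · exact fun i _ => integrable_of_continuous (continuous_const.mul (hx.pow i))
  refine Finset.sum_congr rfl fun k _ => ?_
  rw [integral_const_mul, integral_entry_pow, mul_one_div]

/-! ### Zonal matrix elements -/

/-- The polynomial expressing `tau N N N` through `|α| ^ 2`: a shifted Legendre polynomial. -/
noncomputable def zonalPoly (N : ℕ) : Polynomial ℤ :=
  ∑ x ∈ Finset.HasAntidiagonal.antidiagonal N,
    Polynomial.C (N.choose x.1 * N.choose x.2 : ℤ) *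
      (Polynomial.X ^ x.1 * (Polynomial.X - Polynomial.C 1) ^ x.2)

theorem natDegree_zonalPoly_le (N : ℕ) : (zonalPoly N).natDegree ≤ N := by
  refine Polynomial.natDegree_sum_le_of_forall_le _ _ fun x hx => ?_
  rw [Finset.HasAntidiagonal.mem_antidiagonal] at hx
  refine (Polynomial.natDegree_C_mul_le _ _).trans ?_
  rw [((Polynomial.monic_X_pow x.1).natDegree_mul ((Polynomial.monic_X_sub_C 1).pow x.2)),
    Polynomial.natDegree_X_pow, (Polynomial.monic_X_sub_C (1 : ℤ)).natDegree_pow,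
    Polynomial.natDegree_X_sub_C]
  omega

/-- Each summand is a positive multiple of a monic polynomial of degree `N`. -/
theorem coeff_zonalPoly_pos (N : ℕ) : 0 < (zonalPoly N).coeff N := by
  rw [zonalPoly, Polynomial.finsetSum_coeff]
  refine Finset.sum_pos (fun x hx => ?_) ⟨(0, N), by simp⟩
  rw [Finset.HasAntidiagonal.mem_antidiagonal] at hx
  have hmonic := (Polynomial.monic_X_pow (R := ℤ) x.1).mul ((Polynomial.monic_X_sub_C 1).pow x.2)
  have hdeg : (Polynomial.X ^ x.1 * (Polynomial.X - Polynomial.C (1 : ℤ)) ^ x.2).natDegree = N := by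
    rw [((Polynomial.monic_X_pow x.1).natDegree_mul ((Polynomial.monic_X_sub_C 1).pow x.2)),
      Polynomial.natDegree_X_pow, (Polynomial.monic_X_sub_C (1 : ℤ)).natDegree_pow,
      Polynomial.natDegree_X_sub_C]
    omega
  have h1 := hmonic.coeff_natDegree
  rw [hdeg] at h1
  rw [Polynomial.coeff_C_mul, h1, mul_one]
  have h2 := Nat.choose_pos (show x.1 ≤ N by omega)
  have h3 := Nat.choose_pos (show x.2 ≤ N by omega)
  positivity

theorem tau_self_eq (N : ℕ) (g : SU2) :
    tau N N N g = Polynomial.aeval (g.1 0 0 * g.1 1 1) (zonalPoly N) := by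
  rw [tau, zonalPoly, map_sum]
  refine Finset.sum_congr rfl fun x hx => ?_
  rw [Finset.HasAntidiagonal.mem_antidiagonal] at hx
  have hdet : g.1 0 0 * g.1 1 1 - 1 = g.1 0 1 * g.1 1 0 := by linear_combination det_eq_one g
  simp only [map_mul, map_pow, map_sub, Polynomial.aeval_C, Polynomial.aeval_X, map_one, hdet]
  rw [show N - x.1 = x.2 by omega, show N - x.2 = x.1 by omega]
  simp only [algebraMap_int_eq, eq_intCast, Int.cast_natCast, mul_pow]
  ring

theorem exists_integral_tau_self_pow_ne_zero {M N : ℕ} (h : M < N) {A B : ℂ} (hA : A ≠ 0) :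
    ∃ P : ℕ, 0 < P ∧ ∫ g, (A * tau N N N g + B * tau M M M g) ^ P ∂haar ≠ 0 := by
  obtain ⟨z, rfl⟩ : ∃ z, B = A * z := ⟨B / A, by field_simp⟩
  let R := Algebra.adjoin ℤ {z}
  let y : R := ⟨z, Algebra.subset_adjoin rfl⟩
  let q : Polynomial R :=
    (zonalPoly N).map (algebraMap ℤ R) + Polynomial.C y * (zonalPoly M).map (algebraMap ℤ R)
  have hq : q.natDegree ≤ N := by
    refine Polynomial.natDegree_add_le_of_degree_le
      (Polynomial.natDegree_map_le.trans (natDegree_zonalPoly_le N)) ?_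
    exact (Polynomial.natDegree_C_mul_le _ _).trans
      (Polynomial.natDegree_map_le.trans ((natDegree_zonalPoly_le M).trans h.le))
  have hcoeff : q.coeff N = algebraMap ℤ R ((zonalPoly N).coeff N) := by
    rw [Polynomial.coeff_add, Polynomial.coeff_C_mul, Polynomial.coeff_map, Polynomial.coeff_map,
      Polynomial.coeff_eq_zero_of_natDegree_lt ((natDegree_zonalPoly_le M).trans_lt h), map_zero,
      mul_zero, add_zero]
  have hf (g : SU2) : A * tau N N N g + A * z * tau M M M g =
      A * (q.map (algebraMap R ℂ)).eval (g.1 0 0 * g.1 1 1) := by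
    rw [tau_self_eq, tau_self_eq, Polynomial.map_add, Polynomial.map_mul, Polynomial.map_C,
      Polynomial.map_map, Polynomial.map_map, Polynomial.eval_add, Polynomial.eval_mul,
      Polynomial.eval_C, ← IsScalarTower.algebraMap_eq, Polynomial.eval_map_algebraMap,
      Polynomial.eval_map_algebraMap]
    have : algebraMap R ℂ y = z := rfl
    rw [this]
    ring
  obtain ⟨b, hb⟩ := exists_bound_invertible_primes z
  -- Dirichlet: `p ≡ 1` modulo `N`, beyond the primes invertible in `ℤ[z]` and those dividing the
  -- leading coefficient, which is an integer because `M < N`.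
  obtain ⟨p, hp, hlt, hmod⟩ := Nat.exists_prime_gt_modEq_one (k := N)
    (max b ((zonalPoly N).coeff N).natAbs) (by omega)
  obtain ⟨P, hP⟩ := (Nat.modEq_iff_dvd' hp.one_le).mp hmod.symm
  have hPp : N * P + 1 = p := by
    have := hp.one_le
    omega
  refine ⟨P, Nat.pos_of_ne_zero fun h0 => hp.one_lt.ne ?_, fun hint => ?_⟩
  · rw [← hPp, h0, mul_zero]
  have hsum : ∑ k ∈ Finset.range p, ((q ^ P).coeff k : ℂ) / (k + 1) = 0 := by
    simp only [hf, mul_pow, integral_const_mul, ← Polynomial.eval_pow, ← Polynomial.map_pow] at hint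
    have hdeg : ((q ^ P).map (algebraMap R ℂ)).natDegree < p := by
      refine (Polynomial.natDegree_map_le.trans
        (Polynomial.natDegree_pow_le.trans (Nat.mul_le_mul_left P hq))).trans_lt ?_
      rw [mul_comm]
      omega
    rw [integral_eval _ hdeg] at hint
    simp only [Polynomial.coeff_map] at hint
    exact (mul_eq_zero.mp hint).resolve_left (pow_ne_zero _ hA)
  have hndvd : ¬ (p : ℤ) ∣ (zonalPoly N).coeff N := fun hdvd => by
    have := Nat.le_of_dvd (Int.natAbs_pos.mpr (coeff_zonalPoly_pos N).ne') (Int.natCast_dvd.mp hdvd)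
    have := (le_max_right b ((zonalPoly N).coeff N).natAbs).trans_lt hlt
    omega
  obtain ⟨r, hr, h1⟩ := exists_mul_eq_one_of_sum_eq_zero hp hq hPp hcoeff hndvd hsum
  exact hb p hp ((le_max_left _ _).trans_lt hlt) r hr h1

end SU2

/-! ### The case distinction on relations between the weights -/

theorem mainTheorem2 (ℓ₁ m₁ n₁ ℓ₂ m₂ n₂ : ℚ)
    (hm₁ : SU2.IsSpinWeight ℓ₁ m₁) (hn₁ : SU2.IsSpinWeight ℓ₁ n₁)
    (hm₂ : SU2.IsSpinWeight ℓ₂ m₂) (hn₂ : SU2.IsSpinWeight ℓ₂ n₂)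
    (hne : (ℓ₁, m₁, n₁) ≠ (ℓ₂, m₂, n₂))
    (A₁ A₂ : ℂ) (hA₁ : A₁ ≠ 0) (hA₂ : A₂ ≠ 0) (f : SU2 → ℂ)
    (hf : f = fun g => A₁ * SU2.matrixElt ℓ₁ m₁ n₁ g + A₂ * SU2.matrixElt ℓ₂ m₂ n₂ g)
    (hzero : ∀ P : ℕ, 0 < P → ∫ g, f g ^ P ∂SU2.haar = 0)
    (h : SU2 → ℂ) (hh : IsGFinite h) :
    ∃ P₀ : ℕ, ∀ P : ℕ, P₀ ≤ P → ∫ g, f g ^ P * h g ∂SU2.haar = 0 := by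
  obtain ⟨a₁, b₁, c₁, d₁, κ₁, hκ₁, ha₁, hb₁, hc₁, hd₁, ht₁⟩ := SU2.exists_matrixElt_eq hm₁ hn₁
  obtain ⟨a₂, b₂, c₂, d₂, κ₂, hκ₂, ha₂, hb₂, hc₂, hd₂, ht₂⟩ := SU2.exists_matrixElt_eq hm₂ hn₂
  have hsum₁ : a₁ + b₁ = c₁ + d₁ := by
    have : (a₁ + b₁ : ℚ) = c₁ + d₁ := by linarith
    exact_mod_cast this
  have hsum₂ : a₂ + b₂ = c₂ + d₂ := by
    have : (a₂ + b₂ : ℚ) = c₂ + d₂ := by linarith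
    exact_mod_cast this
  have hB₁ : A₁ * κ₁ ≠ 0 := mul_ne_zero hA₁ (by exact_mod_cast hκ₁)
  have hB₂ : A₂ * κ₂ ≠ 0 := mul_ne_zero hA₂ (by exact_mod_cast hκ₂)
  set F₁ : SU2 → ℂ := fun g => A₁ * κ₁ * SU2.tau a₁ b₁ c₁ g with hF₁
  set F₂ : SU2 → ℂ := fun g => A₂ * κ₂ * SU2.tau a₂ b₂ c₂ g with hF₂
  have hf' : f = fun g => F₁ g + F₂ g := by
    funext g
    simp only [hf, hF₁, hF₂, ht₁, ht₂]
    ring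
  subst hf'
  have hcont₁ : Continuous F₁ := continuous_const.mul (SU2.continuous_tau _ _ _)
  have hcont₂ : Continuous F₂ := continuous_const.mul (SU2.continuous_tau _ _ _)
  have hτ₁ := SU2.hasWeight_tau a₁ b₁ c₁
  have hτ₂ := SU2.hasWeight_tau a₂ b₂ c₂
  set w₁ : ℤ × ℤ := (2 * c₁ - (a₁ + b₁), (a₁ - b₁ : ℤ)) with hw₁
  set w₂ : ℤ × ℤ := (2 * c₂ - (a₂ + b₂), (a₂ - b₂ : ℤ)) with hw₂
  by_cases hrel : ∀ m n : ℕ, m • w₁ + n • w₂ = 0 → m = 0 ∧ n = 0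
  · exact SU2.exists_forall_integral_eq_zero hcont₁ hcont₂ (hτ₁.const_mul _) (hτ₂.const_mul _)
      hrel hh
  exfalso
  push Not at hrel
  obtain ⟨m, n, hmn, hpos⟩ := hrel
  by_cases hw : w₁ = 0 ∧ w₂ = 0
  -- Here all `mᵢ` and `nᵢ` are zero, so the two spins are integers and must differ; the larger one
  -- provides the leading term.
  · obtain ⟨h1, h2⟩ := hw
    simp only [hw₁, hw₂, Prod.mk_eq_zero] at h1 h2
    obtain rfl : a₁ = b₁ := by omega
    obtain rfl : c₁ = a₁ := by omega
    obtain rfl : a₂ = b₂ := by omega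
    obtain rfl : c₂ = a₂ := by omega
    have hcc : c₁ ≠ c₂ := by
      rintro rfl
      apply hne
      rw [Prod.mk.injEq, Prod.mk.injEq]
      refine ⟨?_, ?_, ?_⟩ <;> linarith
    rcases lt_or_gt_of_ne hcc with hlt | hlt
    · obtain ⟨P, hP, hint⟩ := SU2.exists_integral_tau_self_pow_ne_zero hlt hB₂ (B := A₁ * κ₁)
      apply hint
      simpa only [hF₁, hF₂, add_comm] using hzero P hP
    · obtain ⟨P, hP, hint⟩ := SU2.exists_integral_tau_self_pow_ne_zero hlt hB₁ (B := A₂ * κ₂)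
      exact hint (hzero P hP)
  · have hw0 : SU2.HasWeight
        (fun g => SU2.tau a₁ b₁ c₁ g ^ m * SU2.tau a₂ b₂ c₂ g ^ n) 0 :=
      hmn ▸ (hτ₁.pow m).mul (hτ₂.pow n)
    have hint := SU2.integral_sq_tau_mul_tau_ne_zero (by omega) (by omega) hw0
    obtain ⟨P, hP, hne0⟩ := SU2.exists_integral_pow_ne_zero hcont₁ hcont₂ (hτ₁.const_mul _)
      (hτ₂.const_mul _) (by tauto) hmn (by omega) (by
        have hexp (g : SU2) : (F₁ g ^ m * F₂ g ^ n) ^ 2 =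
            ((A₁ * κ₁) ^ m * (A₂ * κ₂) ^ n) ^ 2 *
              (SU2.tau a₁ b₁ c₁ g ^ m * SU2.tau a₂ b₂ c₂ g ^ n) ^ 2 := by
          simp only [hF₁, hF₂]
          ring
        simp only [hexp, integral_const_mul]
        exact mul_ne_zero (pow_ne_zero _ (mul_ne_zero (pow_ne_zero _ hB₁) (pow_ne_zero _ hB₂))) hint)
    exact hne0 (hzero P hP)
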